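/- Let $\mathrm G$ be a connected, simple, undirected graph on $n\ge 2$ nodes with a symmetric weight matrix $[a_{ij}]$, where $a_{ij}\ge 0$, and $a_{ij}>0$ if and only if $(i,j)$ is an edge. Let $C:[0,\infty)\to\mathbb R^m$ be piecewise continuous and bounded (for instance normalized, $\|C(t)\|=1$), and let $t_0\ge 0$. Consider the compressed consensus flow in which the nodes exchange the scalar messages $y_i=C^\top(t)x_i$: $$\dot x_i(t)=\sum_{j=1}^n a_{ij}\,C(t)\big(y_j(t)-y_i(t)\big)=\sum_{j=1}^n a_{ij}\,C(t)C^\top(t)\big(x_j(t)-x_i(t)\big),\qquad i=1,\dots,n,$$ where $x_i(t)\in\mathbb R^m$ and $x=[x_1^\top\ \cdots\ x_n^\top]^\top\in\mathbb R^{mn}$; solutions are continuous and satisfy the equation at the points of continuity of $C$. The flow achieves global linear consensus, i.e. there are constants $c>0$ and $\gamma\in(0,1)$ such that for every initial time $s\ge t_0$ and every initial state $x(s)\in\mathbb R^{mn}$, $$\Big\|x(t)-\mathbf 1_n\otimes \frac1n\sum_{k=1}^n x_k(s)\Big\|^2\le c\,\|x(s)\|^2\,\gamma^{\,t-s}\qquad\text{for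 all } t\ge s,$$ if and only if $C$ is persistently exciting, i.e. there are constants $\alpha,T>0$ such that $$\int_t^{t+T}C(\tau)C^\top(\tau)\,d\tau\succeq\alpha I_m\qquad\text{for all } t\ge t_0 .$$ -/

import Mathlib

open Filter Topology

noncomputable section

namespace CompressedConsensus

/-- The states of all `n` nodes stacked into one vector of `ℝ^(mn)`, with the Euclidean norm
`‖x‖² = ∑ i, ‖x i‖²`. -/
abbrev NetState (n m : ℕ) : Type :=
  PiLp 2 (fun _ : Fin n => EuclideanSpace ℝ (Fin m))

/-- `C` is piecewise continuous on `[0, ∞)`: every bounded interval contains only finitely many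
points of discontinuity, and the finite one-sided limits exist at every point. -/
def PiecewiseContinuous {m : ℕ} (C : ℝ → EuclideanSpace ℝ (Fin m)) : Prop :=
  (∀ b : ℝ, {t : ℝ | t ∈ Set.Icc 0 b ∧ ¬ ContinuousWithinAt C (Set.Ici 0) t}.Finite) ∧
  (∀ t : ℝ, 0 ≤ t → ∃ l, Tendsto C (𝓝[>] t) (𝓝 l)) ∧
  (∀ t : ℝ, 0 < t → ∃ l, Tendsto C (𝓝[<] t) (𝓝 l))

/-- `a` is a weight matrix of the undirected graph `G`: symmetric, entrywise nonnegative, and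
positive exactly at the edges. -/
structure IsWeightMatrix {n : ℕ} (G : SimpleGraph (Fin n)) (a : Matrix (Fin n) (Fin n) ℝ) :
    Prop where
  symm : a.IsSymm
  nonneg : ∀ i j, 0 ≤ a i j
  pos_iff : ∀ i j, 0 < a i j ↔ G.Adj i j

/-- The scalar message `y i = Cᵀ (x i)` sent by node `i`. -/
def message {n m : ℕ} (c : EuclideanSpace ℝ (Fin m)) (x : NetState n m) (i : Fin n) : ℝ :=
  inner ℝ c (x i)

/-- The right-hand side of the compressed consensus flow at node `i`:
`∑ j, a i j * (y j - y i) • C`. -/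
def flowField {n m : ℕ} (a : Matrix (Fin n) (Fin n) ℝ) (c : EuclideanSpace ℝ (Fin m))
    (x : NetState n m) (i : Fin n) : EuclideanSpace ℝ (Fin m) :=
  ∑ j, (a i j * (message c x j - message c x i)) • c

/-- `x` is a solution on `[s, ∞)` of the compressed consensus flow: it is continuous, and it
satisfies the differential equation at every time `t > s` at which `C` is continuous. -/
structure IsSolution {n m : ℕ} (a : Matrix (Fin n) (Fin n) ℝ)
    (C : ℝ → EuclideanSpace ℝ (Fin m)) (s : ℝ) (x : ℝ → NetState n m) : Prop where
  continuousOn : ContinuousOn x (Set.Ici s)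
  hasDerivAt : ∀ t, s < t → ContinuousAt C t →
    ∀ i, HasDerivAt (fun τ => x τ i) (flowField a (C t) (x t) i) t

/-- The average of the node states. -/
def average {n m : ℕ} (x : NetState n m) : EuclideanSpace ℝ (Fin m) :=
  (n : ℝ)⁻¹ • ∑ k, x k

/-- The stacked vector `1 ⊗ v`, all of whose node states equal `v`. -/
def consensus (n : ℕ) {m : ℕ} (v : EuclideanSpace ℝ (Fin m)) : NetState n m :=
  WithLp.toLp 2 (fun _ => v)

/-- Global linear consensus, with constants `c` and `γ` that serve all initial times `s ≥ t₀`
and all initial states `x s`. -/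
def GlobalLinearConsensus {n m : ℕ} (a : Matrix (Fin n) (Fin n) ℝ)
    (C : ℝ → EuclideanSpace ℝ (Fin m)) (t₀ : ℝ) : Prop :=
  ∃ c γ : ℝ, 0 < c ∧ 0 < γ ∧ γ < 1 ∧
    ∀ s, t₀ ≤ s → ∀ x : ℝ → NetState n m, IsSolution a C s x →
      ∀ t, s ≤ t → ‖x t - consensus n (average (x s))‖ ^ 2 ≤ c * ‖x s‖ ^ 2 * γ ^ (t - s)

/-- The matrix `∫ s in t..t+T, C(s) C(s)ᵀ`, integrated entrywise. -/
def excitationGramian {m : ℕ} (C : ℝ → EuclideanSpace ℝ (Fin m)) (t T : ℝ) :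
    Matrix (Fin m) (Fin m) ℝ :=
  Matrix.of fun i j => ∫ s in t..(t + T), C s i * C s j

/-- Persistent excitation: `∫ s in t..t+T, C(s) C(s)ᵀ ⪰ α I` for all `t ≥ t₀`. -/
def PersistentlyExciting {m : ℕ} (C : ℝ → EuclideanSpace ℝ (Fin m)) (t₀ : ℝ) : Prop :=
  ∃ α T : ℝ, 0 < α ∧ 0 < T ∧ ∀ t, t₀ ≤ t →
    (excitationGramian C t T - α • (1 : Matrix (Fin m) (Fin m) ℝ)).PosSemidef

end CompressedConsensus

end

/-! Write P_c for the linear map `messageVec c`. The field is P_cᵀ L P_c, where L is the negative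
graph Laplacian `negLap a`, so energy can be lost only through the messages.

Excitation implies consensus. Symmetric weights conserve the average, so the deviation e from it
solves the same equation and its messages sum to zero. The spectral gap `exists_inner_negLap_le`
then bounds the derivative of ‖e‖² by -2μq², with q = ‖P_C e‖. The speed of e is also at most a
constant times q. Hence, if little energy is dissipated over a period, e barely moves, and its
messages are close to those of the frozen state, whose energy excitation bounds below. So each
period removes a fixed fraction of ‖e‖² (`norm_sq_le_of_excitation`), and iteration gives the
exponential rate (`exponential_bound_of_contraction`).

Consensus implies excitation. Start from v ⊗ u with v a unit vector of sum zero. The average is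
zero, so consensus halves the norm within a uniform time T. The component of the flow along v ⊗ u
carries the factor ⟨C, u⟩, so this decrease forces ∫ |⟨C, u⟩| to be at least a constant times ‖u‖;
Cauchy–Schwarz turns this into the quadratic bound. Since consensus speaks only of given solutions,
this direction needs existence of a solution (`exists_isSolution`). -/

open Filter Topology

noncomputable section

namespace CompressedConsensus

open MeasureTheory intervalIntegral BoundedContinuousFunction

/-! ### Measurability and integrability of the piecewise continuous input -/

section PiecewiseContinuity

variable {m : ℕ} {C : ℝ → EuclideanSpace ℝ (Fin m)}

/-- The points of `[0, ∞)` at which `C` is discontinuous. -/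
def discontinuities (C : ℝ → EuclideanSpace ℝ (Fin m)) : Set ℝ :=
  {t | 0 ≤ t ∧ ¬ ContinuousWithinAt C (Set.Ici 0) t}

theorem PiecewiseContinuous.countable_discontinuities (hC : PiecewiseContinuous C) :
    (discontinuities C).Countable := by
  have h : discontinuities C =
      ⋃ k : ℕ, {t : ℝ | t ∈ Set.Icc 0 (k : ℝ) ∧ ¬ ContinuousWithinAt C (Set.Ici 0) t} := by
    ext t
    simp only [discontinuities, Set.mem_ofPred_eq, Set.mem_iUnion, Set.mem_Icc]
    constructor
    · rintro ⟨h0, h1⟩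
      obtain ⟨k, hk⟩ := exists_nat_ge t
      exact ⟨k, ⟨h0, hk⟩, h1⟩
    · rintro ⟨k, ⟨h0, -⟩, h1⟩
      exact ⟨h0, h1⟩
  rw [h]
  exact Set.countable_iUnion fun k => (hC.1 k).countable

theorem continuousAt_of_notMem_discontinuities {t : ℝ} (ht : 0 < t)
    (h : t ∉ discontinuities C) : ContinuousAt C t := by
  simp only [discontinuities, Set.mem_ofPred_eq, not_and, not_not] at h
  exact (h ht.le).continuousAt (Ici_mem_nhds ht)

/-- The discontinuities form a countable, hence null, set, and `C` is continuous on its complement.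
-/
theorem PiecewiseContinuous.aestronglyMeasurable (hC : PiecewiseContinuous C) :
    AEStronglyMeasurable C (volume.restrict (Set.Ici 0)) := by
  have hD := hC.countable_discontinuities
  have hc : ContinuousOn C (Set.Ici 0 \ discontinuities C) := by
    intro t ht
    have h := ht.2
    simp only [discontinuities, Set.mem_ofPred_eq, not_and, not_not] at h
    exact (h ht.1).mono Set.sdiff_subset
  have h1 := hc.aestronglyMeasurable (μ := volume) (measurableSet_Ici.diff hD.measurableSet)
  have h2 : (Set.Ici 0 \ discontinuities C : Set ℝ) =ᵐ[volume] Set.Ici 0 :=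
    sdiff_null_ae_eq_self (hD.measure_zero _)
  rwa [Measure.restrict_congr_set h2] at h1

/-- Along a continuous path, a continuous function of the bounded input and of the path is
integrable. -/
theorem PiecewiseContinuous.intervalIntegrable_comp {E H : Type*} [NormedAddCommGroup E]
    [ProperSpace E] [NormedAddCommGroup H] (hC : PiecewiseContinuous C)
    {M : ℝ} (hM : ∀ t, 0 ≤ t → ‖C t‖ ≤ M) {G : EuclideanSpace ℝ (Fin m) → E → H}
    (hG : Continuous fun p : EuclideanSpace ℝ (Fin m) × E => G p.1 p.2)
    {x : ℝ → E} {a b : ℝ} (ha : 0 ≤ a) (hab : a ≤ b) (hx : ContinuousOn x (Set.Icc a b)) :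
    IntervalIntegrable (fun τ => G (C τ) (x τ)) volume a b := by
  rw [intervalIntegrable_iff_integrableOn_Icc_of_le hab]
  obtain ⟨R, hR⟩ := isCompact_Icc.exists_bound_of_continuousOn hx
  obtain ⟨B, hB⟩ := ((isCompact_closedBall (0 : EuclideanSpace ℝ (Fin m)) M).prod
    (isCompact_closedBall (0 : E) R)).exists_bound_of_continuousOn hG.continuousOn
  have hCm : AEStronglyMeasurable C (volume.restrict (Set.Icc a b)) :=
    hC.aestronglyMeasurable.mono_measure
      (Measure.restrict_mono (fun t ht => ha.trans ht.1) le_rfl)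
  have hxm : AEStronglyMeasurable x (volume.restrict (Set.Icc a b)) :=
    hx.aestronglyMeasurable measurableSet_Icc
  refine Integrable.of_bound (hG.comp_aestronglyMeasurable (hCm.prodMk hxm)) B ?_
  refine (ae_restrict_iff' measurableSet_Icc).2 (Eventually.of_forall fun t ht => ?_)
  exact hB (C t, x t) ⟨by simpa using hM t (ha.trans ht.1), by simpa using hR t ht⟩

end PiecewiseContinuity

/-! ### Algebra of the flow field and the spectral gap of the graph -/

section Field

variable {n m : ℕ}

/-- All messages, stacked into one vector. -/
def messageVec (c : EuclideanSpace ℝ (Fin m)) (x : NetState n m) : EuclideanSpace ℝ (Fin n) :=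
  WithLp.toLp 2 (message c x)

/-- The stacked vector `v ⊗ c`. -/
def tensor (v : EuclideanSpace ℝ (Fin n)) (c : EuclideanSpace ℝ (Fin m)) : NetState n m :=
  WithLp.toLp 2 fun i => v i • c

/-- The right-hand side of the flow, stacked into one vector. -/
def flowVec (a : Matrix (Fin n) (Fin n) ℝ) (c : EuclideanSpace ℝ (Fin m)) (x : NetState n m) :
    NetState n m :=
  WithLp.toLp 2 (flowField a c x)

/-- The negative weighted graph Laplacian. -/
def negLap (a : Matrix (Fin n) (Fin n) ℝ) :
    EuclideanSpace ℝ (Fin n) →L[ℝ] EuclideanSpace ℝ (Fin n) :=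
  LinearMap.toContinuousLinearMap
    { toFun := fun w => WithLp.toLp 2 fun i => ∑ j, a i j * (w j - w i)
      map_add' := by
        intro v w
        ext i
        simp only [PiLp.add_apply, ← Finset.sum_add_distrib]
        exact Finset.sum_congr rfl fun j _ => by ring
      map_smul' := by
        intro r w
        ext i
        simp only [PiLp.smul_apply, smul_eq_mul, RingHom.id_apply, Finset.mul_sum]
        exact Finset.sum_congr rfl fun j _ => by ring }

theorem negLap_apply (a : Matrix (Fin n) (Fin n) ℝ) (w : EuclideanSpace ℝ (Fin n)) (i : Fin n) :
    negLap a w i = ∑ j, a i j * (w j - w i) := rfl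

theorem messageVec_apply (c : EuclideanSpace ℝ (Fin m)) (x : NetState n m) (i : Fin n) :
    messageVec c x i = inner ℝ c (x i) := rfl

theorem flowVec_eq_tensor (a : Matrix (Fin n) (Fin n) ℝ) (c : EuclideanSpace ℝ (Fin m))
    (x : NetState n m) : flowVec a c x = tensor (negLap a (messageVec c x)) c := by
  ext1 i
  change flowField a c x i = negLap a (messageVec c x) i • c
  rw [negLap_apply, Finset.sum_smul]
  rfl

theorem norm_tensor (v : EuclideanSpace ℝ (Fin n)) (c : EuclideanSpace ℝ (Fin m)) :
    ‖tensor v c‖ = ‖v‖ * ‖c‖ := by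
  rw [← sq_eq_sq₀ (norm_nonneg _) (by positivity), PiLp.norm_sq_eq_of_L2, mul_pow,
    EuclideanSpace.norm_sq_eq v, Finset.sum_mul]
  exact Finset.sum_congr rfl fun i _ => by simp [tensor, norm_smul, mul_pow]

/-- Tensoring with `c` is the adjoint of `messageVec c`; this makes the field a compressed
Laplacian. -/
theorem inner_tensor (z : NetState n m) (v : EuclideanSpace ℝ (Fin n))
    (c : EuclideanSpace ℝ (Fin m)) :
    inner ℝ z (tensor v c) = inner ℝ (messageVec c z) v := by
  rw [PiLp.inner_apply, PiLp.inner_apply]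
  refine Finset.sum_congr rfl fun i _ => ?_
  simp only [tensor, messageVec_apply, inner_smul_right, real_inner_comm c]
  simp

theorem messageVec_tensor (v : EuclideanSpace ℝ (Fin n)) (c u : EuclideanSpace ℝ (Fin m)) :
    messageVec c (tensor v u) = (inner ℝ c u : ℝ) • v := by
  ext i
  simp [messageVec_apply, tensor, inner_smul_right, mul_comm]

theorem messageVec_sub (c : EuclideanSpace ℝ (Fin m)) (x y : NetState n m) :
    messageVec c (x - y) = messageVec c x - messageVec c y := by
  ext i
  simp [messageVec_apply, inner_sub_right]

theorem norm_messageVec_le (c : EuclideanSpace ℝ (Fin m)) (x : NetState n m) :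
    ‖messageVec c x‖ ≤ ‖c‖ * ‖x‖ := by
  rw [← sq_le_sq₀ (norm_nonneg _) (by positivity), mul_pow, EuclideanSpace.norm_sq_eq,
    PiLp.norm_sq_eq_of_L2 _ x, Finset.mul_sum]
  refine Finset.sum_le_sum fun i _ => ?_
  rw [messageVec_apply, ← mul_pow]
  exact pow_le_pow_left₀ (norm_nonneg _) (norm_inner_le_norm c (x i)) 2

theorem norm_flowVec_le (a : Matrix (Fin n) (Fin n) ℝ) (c : EuclideanSpace ℝ (Fin m))
    (x : NetState n m) : ‖flowVec a c x‖ ≤ ‖negLap a‖ * ‖c‖ * ‖messageVec c x‖ := by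
  rw [flowVec_eq_tensor, norm_tensor]
  nlinarith [(negLap a).le_opNorm (messageVec c x), norm_nonneg c]

theorem flowVec_sub (a : Matrix (Fin n) (Fin n) ℝ) (c : EuclideanSpace ℝ (Fin m))
    (x y : NetState n m) : flowVec a c (x - y) = flowVec a c x - flowVec a c y := by
  ext1 i
  simp [flowVec_eq_tensor, messageVec_sub, tensor, sub_smul]

theorem continuous_messageVec : Continuous
    fun p : EuclideanSpace ℝ (Fin m) × NetState n m => messageVec p.1 p.2 := by
  unfold messageVec message
  fun_prop

theorem continuous_flowVec (a : Matrix (Fin n) (Fin n) ℝ) : Continuous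
    fun p : EuclideanSpace ℝ (Fin m) × NetState n m => flowVec a p.1 p.2 := by
  unfold flowVec flowField message
  fun_prop

theorem messageVec_consensus (c v : EuclideanSpace ℝ (Fin m)) (i : Fin n) :
    messageVec c (consensus n v) i = inner ℝ c v := rfl

theorem flowVec_consensus (a : Matrix (Fin n) (Fin n) ℝ) (c v : EuclideanSpace ℝ (Fin m)) :
    flowVec a c (consensus n v) = 0 := by
  ext1 i
  simp [flowVec_eq_tensor, tensor, negLap_apply, messageVec_consensus]

/-- The summand is antisymmetric under exchange of `i` and `j`. -/
theorem sum_negLap {a : Matrix (Fin n) (Fin n) ℝ} (ha : a.IsSymm)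
    (w : EuclideanSpace ℝ (Fin n)) : ∑ i, negLap a w i = 0 := by
  have h : ∑ i, negLap a w i = -∑ i, negLap a w i := by
    simp only [negLap_apply]
    conv_lhs => rw [Finset.sum_comm]
    simp only [← Finset.sum_neg_distrib]
    refine Finset.sum_congr rfl fun i _ => Finset.sum_congr rfl fun j _ => ?_
    rw [ha.apply i j]
    ring
  linarith

/-- Exchanging `i` and `j` gives a second expression for the same inner product; averaging the two
completes the square. -/
theorem inner_negLap {a : Matrix (Fin n) (Fin n) ℝ} (ha : a.IsSymm)
    (w : EuclideanSpace ℝ (Fin n)) :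
    inner ℝ w (negLap a w) = -(∑ i, ∑ j, a i j * (w j - w i) ^ 2) / 2 := by
  have h1 : (inner ℝ w (negLap a w) : ℝ) = ∑ i, ∑ j, a i j * (w j - w i) * w i := by
    rw [PiLp.inner_apply]
    refine Finset.sum_congr rfl fun i _ => ?_
    rw [negLap_apply, ← Finset.sum_mul]
    simp
  have h2 : (inner ℝ w (negLap a w) : ℝ) = ∑ i, ∑ j, a i j * (w i - w j) * w j := by
    rw [h1, Finset.sum_comm]
    refine Finset.sum_congr rfl fun i _ => Finset.sum_congr rfl fun j _ => ?_
    rw [ha.apply i j]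
  have h3 : -(∑ i, ∑ j, a i j * (w j - w i) ^ 2) =
      ∑ i, ∑ j, a i j * (w j - w i) * w i + ∑ i, ∑ j, a i j * (w i - w j) * w j := by
    simp only [← Finset.sum_neg_distrib, ← Finset.sum_add_distrib]
    exact Finset.sum_congr rfl fun i _ => Finset.sum_congr rfl fun j _ => by ring
  rw [h3, ← h1, ← h2]
  ring

theorem average_sub (x y : NetState n m) : average (x - y) = average x - average y := by
  simp [average, smul_sub]

theorem average_consensus (hn : n ≠ 0) (v : EuclideanSpace ℝ (Fin m)) :
    average (consensus n v) = v := by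
  have : (n : ℝ) ≠ 0 := by exact_mod_cast hn
  simp [average, consensus, ← Nat.cast_smul_eq_nsmul ℝ, smul_smul, this]

theorem sum_eq_smul_average (hn : n ≠ 0) (x : NetState n m) :
    ∑ i, x i = (n : ℝ) • average x := by
  have : (n : ℝ) ≠ 0 := by exact_mod_cast hn
  simp [average, smul_smul, this]

theorem sum_messageVec (hn : n ≠ 0) (c : EuclideanSpace ℝ (Fin m)) (x : NetState n m) :
    ∑ i, messageVec c x i = n * inner ℝ c (average x) := by
  simp only [messageVec_apply]
  rw [← inner_sum, sum_eq_smul_average hn, inner_smul_right]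

theorem average_flowVec {a : Matrix (Fin n) (Fin n) ℝ} (ha : a.IsSymm)
    (c : EuclideanSpace ℝ (Fin m)) (x : NetState n m) : average (flowVec a c x) = 0 := by
  have : ∑ k, flowVec a c x k = (∑ k, negLap a (messageVec c x) k) • c := by
    rw [flowVec_eq_tensor, Finset.sum_smul]
    rfl
  simp [average, this, sum_negLap ha]

/-- The deviation from the average is an orthogonal projection. -/
theorem norm_sub_consensus_average_le (hn : n ≠ 0) (x : NetState n m) :
    ‖x - consensus n (average x)‖ ≤ ‖x‖ := by
  have h : (inner ℝ (x - consensus n (average x)) (consensus n (average x)) : ℝ) = 0 := by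
    rw [PiLp.inner_apply]
    change ∑ i, inner ℝ ((x - consensus n (average x)) i) (average x) = 0
    rw [← sum_inner, sum_eq_smul_average hn, average_sub, average_consensus hn]
    simp
  have h2 := norm_add_sq_real (x - consensus n (average x)) (consensus n (average x))
  rw [h, sub_add_cancel] at h2
  refine le_of_sq_le_sq ?_ (norm_nonneg _)
  nlinarith [sq_nonneg ‖consensus n (average x)‖]

/-- The Poincaré inequality of a connected weighted graph. -/
theorem exists_inner_negLap_le {G : SimpleGraph (Fin n)} (hG : G.Connected)
    {a : Matrix (Fin n) (Fin n) ℝ} (ha : IsWeightMatrix G a) :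
    ∃ μ : ℝ, 0 < μ ∧ ∀ w : EuclideanSpace ℝ (Fin n), ∑ i, w i = 0 →
      inner ℝ w (negLap a w) ≤ -μ * ‖w‖ ^ 2 := by
  -- The form is continuous and homogeneous of degree two, so strict negativity on this compact set
  -- yields a uniform gap.
  set S : Set (EuclideanSpace ℝ (Fin n)) := {w | ∑ i, w i = 0} ∩ Metric.sphere 0 1 with hS
  have hSc : IsCompact S := by
    refine (isCompact_sphere _ _).inter_left ?_
    exact isClosed_eq (by fun_prop) continuous_const
  have hneg : ∀ w ∈ S, inner ℝ w (negLap a w) < (0 : ℝ) := by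
    rintro w ⟨hw0, hw1⟩
    rw [inner_negLap ha.symm]
    have hnn : ∀ i j, 0 ≤ a i j * (w j - w i) ^ 2 := fun i j =>
      mul_nonneg (ha.nonneg i j) (sq_nonneg _)
    have hnn' : 0 ≤ ∑ i, ∑ j, a i j * (w j - w i) ^ 2 :=
      Finset.sum_nonneg fun i _ => Finset.sum_nonneg fun j _ => hnn i j
    rcases hnn'.lt_or_eq with h | h
    · linarith
    -- If the form vanishes, `w` agrees across every edge, hence is constant by connectivity, hence
    -- zero because its sum is zero. This contradicts `‖w‖ = 1`.
    exfalso
    have hadj : ∀ i j, G.Adj i j → w i = w j := by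
      intro i j hij
      have h1 := (Finset.sum_eq_zero_iff_of_nonneg
        fun i _ => Finset.sum_nonneg fun j _ => hnn i j).1 h.symm i (Finset.mem_univ i)
      have h2 := (Finset.sum_eq_zero_iff_of_nonneg fun j _ => hnn i j).1 h1 j (Finset.mem_univ j)
      have h3 := (ha.pos_iff i j).2 hij
      have h4 : (w j - w i) ^ 2 = 0 := (mul_eq_zero.1 h2).resolve_left h3.ne'
      have h5 := pow_eq_zero_iff (two_ne_zero) |>.1 h4
      linarith
    have hconst : ∀ i j, w i = w j := by
      intro i j
      obtain ⟨p⟩ := hG.preconnected i j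
      induction p with
      | nil => rfl
      | cons h _ ih => exact (hadj _ _ h).trans ih
    have hw : w = 0 := by
      ext i
      have h1 : ∑ j, w j = n * w i := by
        rw [Finset.sum_congr rfl fun j _ => hconst j i]
        simp
      have hn : (n : ℝ) ≠ 0 := by
        have := i.pos
        exact_mod_cast this.ne'
      rw [Set.mem_ofPred_eq, h1] at hw0
      simpa [hn] using hw0
    simp [hw] at hw1
  -- For a single node the only zero-sum vector is zero, and any positive constant serves.
  rcases S.eq_empty_or_nonempty with hE | hE
  · refine ⟨1, one_pos, fun w hw => ?_⟩
    by_cases h0 : w = 0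
    · simp [h0]
    exfalso
    have : (‖w‖⁻¹ • w) ∈ S := by
      refine ⟨?_, ?_⟩
      · simp [← Finset.mul_sum, hw]
      · simp [norm_smul, h0]
    simp [hE] at this
  · obtain ⟨w₀, hw₀, hmax⟩ := hSc.exists_isMaxOn hE
      (f := fun w => (inner ℝ w (negLap a w) : ℝ)) (by fun_prop)
    refine ⟨-inner ℝ w₀ (negLap a w₀), by linarith [hneg w₀ hw₀], fun w hw => ?_⟩
    by_cases h0 : w = 0
    · simp [h0]
    have hmem : (‖w‖⁻¹ • w) ∈ S := by
      refine ⟨?_, ?_⟩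
      · simp [← Finset.mul_sum, hw]
      · simp [norm_smul, h0]
    have h1 : (inner ℝ (‖w‖⁻¹ • w) (negLap a (‖w‖⁻¹ • w)) : ℝ) ≤ inner ℝ w₀ (negLap a w₀) :=
      hmax hmem
    have hpos : 0 < ‖w‖ := norm_pos_iff.2 h0
    rw [map_smul, inner_smul_left, inner_smul_right] at h1
    simp only [conj_trivial] at h1
    rw [neg_neg]
    calc (inner ℝ w (negLap a w) : ℝ)
        = (‖w‖⁻¹ * (‖w‖⁻¹ * inner ℝ w (negLap a w))) * ‖w‖ ^ 2 := by field_simp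
      _ ≤ _ := by gcongr

end Field

/-! ### Persistent excitation as a scalar inequality -/

section Gramian

variable {m : ℕ} {C : ℝ → EuclideanSpace ℝ (Fin m)}

/-- The quadratic form of the Gramian at `u` is the integral of ⟨C, u⟩², since the finite double sum
commutes with the integral. -/
theorem posSemidef_excitationGramian_sub_iff (hC : PiecewiseContinuous C)
    {M : ℝ} (hM : ∀ t, 0 ≤ t → ‖C t‖ ≤ M) {α t T : ℝ} (ht : 0 ≤ t) (hT : 0 ≤ T) :
    (excitationGramian C t T - α • (1 : Matrix (Fin m) (Fin m) ℝ)).PosSemidef ↔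
      ∀ u : EuclideanSpace ℝ (Fin m), α * ‖u‖ ^ 2 ≤ ∫ τ in t..t + T, (inner ℝ (C τ) u) ^ 2 := by
  have hsymm : (excitationGramian C t T - α • (1 : Matrix (Fin m) (Fin m) ℝ)).IsHermitian := by
    refine Matrix.IsHermitian.sub ?_ ?_
    · ext i j
      simp [excitationGramian, mul_comm]
    · ext i j
      simp [Matrix.one_apply, eq_comm]
  have hint : ∀ i j, IntervalIntegrable (fun τ => C τ i * C τ j) volume t (t + T) := fun i j =>
    hC.intervalIntegrable_comp hM (G := fun c (_ : ℝ) => c i * c j) (x := fun _ => (0 : ℝ))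
      (by fun_prop) ht (by linarith) continuousOn_const
  have hquad : ∀ u : EuclideanSpace ℝ (Fin m),
      (u.ofLp ⬝ᵥ (excitationGramian C t T - α • (1 : Matrix (Fin m) (Fin m) ℝ)).mulVec u.ofLp) =
        (∫ τ in t..t + T, (inner ℝ (C τ) u) ^ 2) - α * ‖u‖ ^ 2 := by
    intro u
    have h1 : ∀ τ, (inner ℝ (C τ) u : ℝ) ^ 2 = ∑ i, ∑ j, (C τ i * C τ j) * (u i * u j) := by
      intro τ
      rw [PiLp.inner_apply, sq, Finset.sum_mul_sum]
      refine Finset.sum_congr rfl fun i _ => Finset.sum_congr rfl fun j _ => ?_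
      simp
      ring
    simp only [h1]
    have hint' : ∀ i, IntervalIntegrable
        (fun τ => ∑ j, (C τ i * C τ j) * (u i * u j)) volume t (t + T) := fun i => by
      simpa only [Finset.sum_fn] using IntervalIntegrable.sum Finset.univ
        fun j _ => (hint i j).mul_const (u i * u j)
    have h2 : ∀ i, ∫ τ in t..t + T, ∑ j, (C τ i * C τ j) * (u i * u j) =
        ∑ j, (∫ τ in t..t + T, C τ i * C τ j) * (u i * u j) := fun i => by
      rw [integral_finsetSum fun j _ => (hint i j).mul_const _]
      simp only [intervalIntegral.integral_mul_const]
    rw [integral_finsetSum fun i _ => hint' i]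
    simp only [h2]
    rw [Matrix.sub_mulVec, dotProduct_sub, Matrix.smul_mulVec, Matrix.one_mulVec,
      dotProduct_smul, EuclideanSpace.norm_sq_eq]
    congr 1
    · simp only [dotProduct, Matrix.mulVec, excitationGramian, Matrix.of_apply, Finset.mul_sum]
      exact Finset.sum_congr rfl fun i _ => Finset.sum_congr rfl fun j _ => by ring
    · simp [dotProduct, sq]
  rw [Matrix.posSemidef_iff_dotProduct_mulVec]
  constructor
  · rintro ⟨-, h⟩ u
    have := h u.ofLp
    rw [star_trivial, hquad] at this
    linarith
  · refine fun h => ⟨hsymm, fun u => ?_⟩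
    have := hquad (WithLp.toLp 2 u)
    rw [star_trivial]
    rw [this]
    linarith [h (WithLp.toLp 2 u)]

end Gramian

/-! ### Existence of solutions for a merely measurable input -/

section Existence

theorem integral_exp_mul_sub {L : ℝ} (hL : 0 < L) (s t : ℝ) :
    ∫ τ in s..t, Real.exp (L * (τ - s)) = (Real.exp (L * (t - s)) - 1) / L := by
  have h : ∀ τ ∈ Set.uIcc s t,
      HasDerivAt (fun τ => Real.exp (L * (τ - s)) / L) (Real.exp (L * (τ - s))) τ := by
    intro τ _
    have := ((((hasDerivAt_id τ).sub_const s).const_mul L).exp).div_const L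
    refine this.congr_deriv ?_
    simp [hL.ne']
  rw [integral_eq_sub_of_hasDerivAt h (Continuous.intervalIntegrable (by fun_prop) _ _)]
  simp
  ring

/-- In the norm weighted by exp(-L(t - s)), integration from `s` gains a factor 1/L; this makes the
Picard map a contraction on the whole half-line. -/
theorem norm_exp_smul_integral_le {E : Type*} [NormedAddCommGroup E] [NormedSpace ℝ E]
    {L B s t : ℝ} (hL : 0 < L) (hB : 0 ≤ B) (hst : s ≤ t) {h : ℝ → E}
    (hh : ∀ τ, ‖h τ‖ ≤ B * Real.exp (L * (τ - s))) :
    ‖Real.exp (-(L * (t - s))) • ∫ τ in s..t, h τ‖ ≤ B / L := by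
  have h1 : ‖∫ τ in s..t, h τ‖ ≤ ∫ τ in s..t, B * Real.exp (L * (τ - s)) :=
    intervalIntegral.norm_integral_le_of_norm_le hst (Eventually.of_forall fun τ _ => hh τ)
      (Continuous.intervalIntegrable (by fun_prop) _ _)
  rw [intervalIntegral.integral_const_mul, integral_exp_mul_sub hL] at h1
  rw [norm_smul, Real.norm_eq_abs, Real.abs_exp, Real.exp_neg, inv_mul_le_iff₀ (Real.exp_pos _)]
  refine h1.trans ?_
  rw [mul_div_assoc', mul_div_assoc', div_le_div_iff_of_pos_right hL]
  nlinarith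

/-- A globally Lipschitz integral equation with measurable time dependence has a global forward
solution. -/
theorem exists_integral_solution {E : Type*} [NormedAddCommGroup E] [NormedSpace ℝ E]
    [CompleteSpace E] {f : ℝ → E → E} {K : ℝ} (hK : 0 < K)
    (hlip : ∀ t x y, ‖f t x - f t y‖ ≤ K * ‖x - y‖) (hzero : ∀ t, f t 0 = 0)
    (hmeas : ∀ x : ℝ → E, Continuous x → AEStronglyMeasurable (fun t => f t (x t)) volume)
    (s : ℝ) (x₀ : E) :
    ∃ x : ℝ → E, Continuous x ∧ (∀ a b, IntervalIntegrable (fun t => f t (x t)) volume a b) ∧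
      ∀ t, s ≤ t → x t = x₀ + ∫ τ in s..t, f τ (x τ) := by
  have hbd : ∀ t x, ‖f t x‖ ≤ K * ‖x‖ := fun t x => by simpa [hzero] using hlip t x 0
  have hint : ∀ x : ℝ → E, Continuous x → ∀ a b,
      IntervalIntegrable (fun t => f t (x t)) volume a b := fun x hx a b =>
    ((hx.norm.const_mul K).intervalIntegrable a b).mono_fun (hmeas x hx).restrict
      (Eventually.of_forall fun t => (hbd t (x t)).trans (le_abs_self _))
  -- The unknown is `y τ = exp(-2K(τ - s)) • x τ`. The weight 2K against the Lipschitz constant K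
  -- gives the contraction factor 1/2.
  set g : (ℝ →ᵇ E) → ℝ → E := fun y τ => f τ (Real.exp (2 * K * (τ - s)) • y τ) with hg
  have hcont : ∀ y : ℝ →ᵇ E, Continuous fun τ => Real.exp (2 * K * (τ - s)) • y τ :=
    fun y => by fun_prop
  have hgint : ∀ y a b, IntervalIntegrable (g y) volume a b := fun y a b => hint _ (hcont y) a b
  have hgcont : ∀ y, Continuous fun t => ∫ τ in s..max t s, g y τ := fun y =>
    (continuous_primitive (hgint y) s).comp (continuous_id.max continuous_const)
  -- Replacing `t` by `max t s` freezes the image before `s`, so that it is bounded on all of ℝ.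
  set Φ : (ℝ →ᵇ E) → (ℝ →ᵇ E) := fun y =>
    BoundedContinuousFunction.ofNormedAddCommGroup
      (fun t => Real.exp (-(2 * K * (max t s - s))) • (x₀ + ∫ τ in s..max t s, g y τ))
      (by have := hgcont y; fun_prop)
      (‖x₀‖ + K * ‖y‖ / (2 * K))
      (by
        intro t
        rw [smul_add]
        refine (norm_add_le _ _).trans (add_le_add ?_ ?_)
        · rw [norm_smul, Real.norm_eq_abs, Real.abs_exp]
          refine mul_le_of_le_one_left (norm_nonneg _) (Real.exp_le_one_iff.2 ?_)
          have := le_max_right t s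
          nlinarith
        · refine norm_exp_smul_integral_le (by positivity) (by positivity) (le_max_right t s) ?_
          intro τ
          refine (hbd _ _).trans ?_
          rw [norm_smul, Real.norm_eq_abs, Real.abs_exp, mul_left_comm, mul_comm (K * _)]
          gcongr
          exact y.norm_coe_le_norm τ) with hΦ
  have hΦc : ContractingWith (1 / 2) Φ := by
    refine ⟨by norm_num, LipschitzWith.of_dist_le_mul fun y z => ?_⟩
    rw [BoundedContinuousFunction.dist_le (by positivity)]
    intro t
    have h1 : Φ y t - Φ z t =
        Real.exp (-(2 * K * (max t s - s))) • ∫ τ in s..max t s, (g y τ - g z τ) := by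
      rw [intervalIntegral.integral_sub (hgint y _ _) (hgint z _ _), smul_sub]
      simp only [hΦ, BoundedContinuousFunction.coe_ofNormedAddCommGroup, smul_add]
      abel
    rw [dist_eq_norm, h1]
    refine (norm_exp_smul_integral_le (B := K * dist y z) (by positivity) (by positivity)
      (le_max_right t s) ?_).trans (le_of_eq ?_)
    · intro τ
      refine (hlip _ _ _).trans ?_
      rw [← smul_sub, norm_smul, Real.norm_eq_abs, Real.abs_exp, mul_left_comm,
        mul_comm (K * _), ← dist_eq_norm]
      gcongr
      exact BoundedContinuousFunction.dist_coe_le_dist τ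
    · push_cast
      field_simp
  obtain ⟨y, hy⟩ : ∃ y, Φ y = y := ⟨_, hΦc.fixedPoint_isFixedPt⟩
  refine ⟨fun τ => Real.exp (2 * K * (τ - s)) • y τ, hcont y, hint _ (hcont y), fun t ht => ?_⟩
  have h1 : y t = Real.exp (-(2 * K * (t - s))) • (x₀ + ∫ τ in s..t, g y τ) := by
    conv_lhs => rw [← hy]
    simp only [hΦ, BoundedContinuousFunction.coe_ofNormedAddCommGroup, max_eq_left ht]
  change Real.exp (2 * K * (t - s)) • y t = x₀ + ∫ τ in s..t, g y τ
  rw [h1, smul_smul, ← Real.exp_add, add_neg_cancel, Real.exp_zero, one_smul]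

/-- The solution satisfies the differential equation wherever its right-hand side is
continuous. -/
theorem exists_forward_solution {E : Type*} [NormedAddCommGroup E] [NormedSpace ℝ E]
    [CompleteSpace E] {f : ℝ → E → E} {K : ℝ} (hK : 0 < K)
    (hlip : ∀ t x y, ‖f t x - f t y‖ ≤ K * ‖x - y‖) (hzero : ∀ t, f t 0 = 0)
    (hmeas : ∀ x : ℝ → E, Continuous x → AEStronglyMeasurable (fun t => f t (x t)) volume)
    (s : ℝ) (x₀ : E) :
    ∃ x : ℝ → E, Continuous x ∧ x s = x₀ ∧
      ∀ t, s < t → ContinuousAt (fun τ => f τ (x τ)) t → HasDerivAt x (f t (x t)) t := by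
  obtain ⟨x, hx, hxi, hxs⟩ := exists_integral_solution hK hlip hzero hmeas s x₀
  refine ⟨x, hx, by simpa using hxs s le_rfl, fun t hst ht => ?_⟩
  refine HasDerivAt.congr_of_eventuallyEq ((integral_hasDerivAt_right (hxi s t)
    (hmeas x hx).stronglyMeasurableAtFilter ht).const_add x₀) ?_
  filter_upwards [Ici_mem_nhds hst] with τ hτ
  exact hxs τ hτ

theorem continuousSMul_piLp (n : ℕ) (E : Type*) [NormedAddCommGroup E] [NormedSpace ℝ E] :
    ContinuousSMul ℝ (PiLp 2 fun _ : Fin n => E) := inferInstance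

theorem aestronglyMeasurable_comp_prodMk {F E H : Type*} [TopologicalSpace F]
    [NormedAddCommGroup E] [NormedAddCommGroup H] {G : F → E → H}
    (hG : Continuous fun p : F × E => G p.1 p.2) {c : ℝ → F}
    (hc : AEStronglyMeasurable c volume) {z : ℝ → E} (hz : Continuous z) :
    AEStronglyMeasurable (fun t => G (c t) (z t)) volume :=
  hG.comp_aestronglyMeasurable (hc.prodMk hz.aestronglyMeasurable)

/-- A shortcut: the default search for this instance is very slow. -/
instance instContinuousSMulNetState (n m : ℕ) : ContinuousSMul ℝ (NetState n m) :=
  continuousSMul_piLp n _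

section PiLpDerivative

variable {n : ℕ} {E : Type*} [NormedAddCommGroup E] [NormedSpace ℝ E]
  {x : ℝ → PiLp 2 fun _ : Fin n => E} {x' : PiLp 2 fun _ : Fin n => E} {t : ℝ}

theorem hasDerivAt_piLp_apply (h : HasDerivAt x x' t) (i : Fin n) :
    HasDerivAt (fun τ => x τ i) (x' i) t :=
  (PiLp.proj (𝕜 := ℝ) 2 (fun _ : Fin n => E) i).hasFDerivAt.comp_hasDerivAt t h

theorem hasDerivAt_piLp_of_apply (h : ∀ i, HasDerivAt (fun τ => x τ i) (x' i) t) :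
    HasDerivAt x x' t := by
  have h1 := hasDerivAt_pi.2 h
  exact ((PiLp.continuousLinearEquiv 2 ℝ
    fun _ : Fin n => E).symm.toContinuousLinearMap.hasFDerivAt).comp_hasDerivAt t h1

end PiLpDerivative

variable {n m : ℕ} {C : ℝ → EuclideanSpace ℝ (Fin m)}

/-- The compressed consensus flow has a solution from every initial state. -/
theorem exists_isSolution (a : Matrix (Fin n) (Fin n) ℝ) (hC : PiecewiseContinuous C)
    {M : ℝ} (hM : ∀ t, 0 ≤ t → ‖C t‖ ≤ M) {s : ℝ} (hs : 0 ≤ s) (x₀ : NetState n m) :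
    ∃ x, IsSolution a C s x ∧ x s = x₀ := by
  have hM0 : 0 ≤ M := (norm_nonneg _).trans (hM 0 le_rfl)
  -- Extension by zero makes the bound and the measurability hold at all times; nothing changes near
  -- any `t > s`.
  set C' : ℝ → EuclideanSpace ℝ (Fin m) := (Set.Ici 0).indicator C with hC'
  have hC'meas : AEStronglyMeasurable C' volume :=
    (aestronglyMeasurable_indicator_iff measurableSet_Ici).2 hC.aestronglyMeasurable
  have hC'M : ∀ t, ‖C' t‖ ≤ M := by
    intro t
    by_cases ht : t ∈ Set.Ici (0 : ℝ)
    · rw [hC', Set.indicator_of_mem ht]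
      exact hM t ht
    · rw [hC', Set.indicator_of_notMem ht]
      simpa using hM0
  -- The added 1 keeps the Lipschitz constant positive even if `M` or the Laplacian vanishes.
  have hbd : ∀ t (z : NetState n m), ‖flowVec a (C' t) z‖ ≤ (‖negLap a‖ * M * M + 1) * ‖z‖ := by
    intro t z
    calc ‖flowVec a (C' t) z‖ ≤ ‖negLap a‖ * ‖C' t‖ * ‖messageVec (C' t) z‖ := norm_flowVec_le ..
      _ ≤ ‖negLap a‖ * ‖C' t‖ * (‖C' t‖ * ‖z‖) := by gcongr; exact norm_messageVec_le ..
      _ ≤ ‖negLap a‖ * M * (M * ‖z‖) := by gcongr <;> exact hC'M t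
      _ ≤ _ := by nlinarith [norm_nonneg z]
  have hlip : ∀ t (z w : NetState n m), ‖flowVec a (C' t) z - flowVec a (C' t) w‖ ≤
      (‖negLap a‖ * M * M + 1) * ‖z - w‖ := fun t z w => by
    rw [← flowVec_sub]
    exact hbd t _
  have hzero : ∀ t, flowVec a (C' t) (0 : NetState n m) = 0 := fun t =>
    norm_le_zero_iff.1 (by simpa using hbd t 0)
  have hmeas : ∀ z : ℝ → NetState n m, Continuous z →
      AEStronglyMeasurable (fun t => flowVec a (C' t) (z t)) volume := fun z hz =>
    aestronglyMeasurable_comp_prodMk (continuous_flowVec a) hC'meas hz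
  obtain ⟨x, hx, hxs, hxd⟩ := exists_forward_solution (f := fun t z => flowVec a (C' t) z)
    (K := ‖negLap a‖ * M * M + 1) (by positivity) hlip hzero hmeas s x₀
  refine ⟨x, ⟨hx.continuousOn, fun t hst hCt i => ?_⟩, hxs⟩
  have ht : 0 < t := hs.trans_lt hst
  have hCC' : C' =ᶠ[𝓝 t] C := by
    filter_upwards [Ici_mem_nhds ht] with τ hτ
    exact Set.indicator_of_mem hτ C
  have hC't : ContinuousAt C' t := hCt.congr_of_eventuallyEq hCC'
  have hcont : ContinuousAt (fun τ => flowVec a (C' τ) (x τ)) t :=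
    (continuous_flowVec a).continuousAt.comp_of_eq
      (f := fun τ => (C' τ, x τ)) (hC't.prodMk hx.continuousAt) rfl
  have hderiv := hasDerivAt_piLp_apply (hxd t hst hcont) i
  rwa [hCC'.eq_of_nhds] at hderiv

end Existence

/-! ### Energy estimates and exponential decay -/

section Estimates

/-- Cauchy–Schwarz against the constant 1, obtained from nonnegativity of the integrated squared
deviation of `q` from its mean `β`. -/
theorem sq_integral_le {q : ℝ → ℝ} {a b : ℝ} (hab : a < b)
    (hq : IntervalIntegrable q volume a b)
    (hq2 : IntervalIntegrable (fun τ => q τ ^ 2) volume a b) :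
    (∫ τ in a..b, q τ) ^ 2 ≤ (b - a) * ∫ τ in a..b, q τ ^ 2 := by
  set Q := ∫ τ in a..b, q τ with hQ
  set β := Q / (b - a) with hβ
  have hba : 0 < b - a := sub_pos.2 hab
  have h0 : 0 ≤ ∫ τ in a..b, (q τ - β) ^ 2 :=
    integral_nonneg hab.le fun τ _ => sq_nonneg _
  have h1 : ∫ τ in a..b, (q τ - β) ^ 2 =
      (∫ τ in a..b, q τ ^ 2) - 2 * β * Q + (b - a) * β ^ 2 := by
    have : ∀ τ, (q τ - β) ^ 2 = q τ ^ 2 - 2 * β * q τ + β ^ 2 := fun τ => by ring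
    simp only [this]
    rw [intervalIntegral.integral_add (hq2.sub (hq.const_mul _)) (by simp),
      intervalIntegral.integral_sub hq2 (hq.const_mul _), intervalIntegral.integral_const_mul]
    simp [hQ]
  rw [h1] at h0
  have h2 : (b - a) * β = Q := by
    rw [hβ]
    field_simp
  nlinarith

variable {E : Type*} [NormedAddCommGroup E] [InnerProductSpace ℝ E]

theorem norm_sq_sub_norm_sq_eq_integral {e F : ℝ → E} {D : Set ℝ} (hD : D.Countable)
    {a b : ℝ} (hab : a ≤ b) (he : ContinuousOn e (Set.Icc a b))
    (hd : ∀ τ, a < τ → τ ∉ D → HasDerivAt e (F τ) τ)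
    (hi : IntervalIntegrable (fun τ => (inner ℝ (e τ) (F τ) : ℝ)) volume a b) :
    ‖e b‖ ^ 2 - ‖e a‖ ^ 2 = 2 * ∫ τ in a..b, (inner ℝ (e τ) (F τ) : ℝ) := by
  rw [← intervalIntegral.integral_const_mul]
  refine (integral_eq_of_hasDerivAt_off_countable_of_le (fun τ => ‖e τ‖ ^ 2) _ hab hD
    (he.norm.pow 2) (fun τ hτ => ?_) (hi.const_mul 2)).symm
  exact (hd τ hτ.1.1 hτ.2).norm_sq

theorem norm_le_of_inner_deriv_nonpos {e F : ℝ → E} {D : Set ℝ} (hD : D.Countable)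
    {a b : ℝ} (hab : a ≤ b) (he : ContinuousOn e (Set.Icc a b))
    (hd : ∀ τ, a < τ → τ ∉ D → HasDerivAt e (F τ) τ)
    (hi : IntervalIntegrable (fun τ => (inner ℝ (e τ) (F τ) : ℝ)) volume a b)
    (hF : ∀ τ, a ≤ τ → (inner ℝ (e τ) (F τ) : ℝ) ≤ 0) : ‖e b‖ ^ 2 ≤ ‖e a‖ ^ 2 := by
  have h := norm_sq_sub_norm_sq_eq_integral hD hab he hd hi
  have h0 : ∫ τ in a..b, (inner ℝ (e τ) (F τ) : ℝ) ≤ ∫ τ in a..b, (0 : ℝ) :=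
    integral_mono_on hab hi (by simp) fun τ hτ => hF τ hτ.1
  rw [intervalIntegral.integral_zero] at h0
  linarith

/-- One period of excitation contracts the energy: the dissipation rate `μ q²` controls both the
observed signal and the drift, hence the whole state through the excitation bound. -/
theorem norm_sq_le_of_excitation [CompleteSpace E] {e F : ℝ → E} {q p : ℝ → ℝ} {D : Set ℝ}
    (hD : D.Countable) {t T μ K M α : ℝ} (hT : 0 < T) (hμ : 0 ≤ μ) (hK : 0 ≤ K) (hM : 0 ≤ M)
    (he : ContinuousOn e (Set.Icc t (t + T)))
    (hd : ∀ τ, t < τ → τ ∉ D → HasDerivAt e (F τ) τ)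
    (hFi : IntervalIntegrable F volume t (t + T))
    (heFi : IntervalIntegrable (fun τ => (inner ℝ (e τ) (F τ) : ℝ)) volume t (t + T))
    (hqi : IntervalIntegrable q volume t (t + T))
    (hq2i : IntervalIntegrable (fun τ => q τ ^ 2) volume t (t + T))
    (hp2i : IntervalIntegrable (fun τ => p τ ^ 2) volume t (t + T))
    (hq : ∀ τ, 0 ≤ q τ) (hp : ∀ τ, 0 ≤ p τ)
    (hdis : ∀ τ, t ≤ τ → (inner ℝ (e τ) (F τ) : ℝ) ≤ -μ * q τ ^ 2)
    (hF : ∀ τ, t ≤ τ → ‖F τ‖ ≤ K * q τ)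
    (hpq : ∀ τ, t ≤ τ → p τ ≤ q τ + M * ‖e τ - e t‖)
    (hexc : α * ‖e t‖ ^ 2 ≤ ∫ τ in t..t + T, p τ ^ 2) :
    ‖e (t + T)‖ ^ 2 ≤ (1 - μ * α / (1 + (T * M * K) ^ 2)) * ‖e t‖ ^ 2 := by
  have htT : t ≤ t + T := by linarith
  set Q := ∫ τ in t..t + T, q τ with hQ
  set S := ∫ τ in t..t + T, q τ ^ 2 with hS
  have hCS : Q ^ 2 ≤ T * S := by
    have := sq_integral_le (by linarith : t < t + T) hqi hq2i
    rwa [add_sub_cancel_left] at this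
  -- The displacement is the integral of `F`, so it is controlled by the integral of `q` over the
  -- whole period.
  have hdrift : ∀ τ ∈ Set.Icc t (t + T), ‖e τ - e t‖ ≤ K * Q := by
    intro τ hτ
    have hsub : Set.uIcc t τ ⊆ Set.uIcc t (t + T) := by
      rw [Set.uIcc_of_le hτ.1, Set.uIcc_of_le htT]
      exact Set.Icc_subset_Icc_right hτ.2
    have h1 : ∫ σ in t..τ, F σ = e τ - e t :=
      integral_eq_of_hasDerivAt_off_countable_of_le e F hτ.1 hD
        (he.mono (Set.Icc_subset_Icc_right hτ.2)) (fun σ hσ => hd σ hσ.1.1 hσ.2)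
        (hFi.mono_set hsub)
    rw [← h1]
    calc ‖∫ σ in t..τ, F σ‖ ≤ ∫ σ in t..τ, K * q σ :=
          intervalIntegral.norm_integral_le_of_norm_le hτ.1
            (Eventually.of_forall fun σ hσ => hF σ hσ.1.le) ((hqi.mono_set hsub).const_mul K)
      _ = K * ∫ σ in t..τ, q σ := intervalIntegral.integral_const_mul _ _
      _ ≤ K * Q := by
          refine mul_le_mul_of_nonneg_left ?_ hK
          exact integral_mono_interval le_rfl hτ.1 hτ.2 (Eventually.of_forall hq) hqi
  have hp2 : ∫ τ in t..t + T, p τ ^ 2 ≤ 2 * S + 2 * T * (M * K * Q) ^ 2 := by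
    have h1 : ∫ τ in t..t + T, p τ ^ 2 ≤ ∫ τ in t..t + T, (2 * q τ ^ 2 + 2 * (M * K * Q) ^ 2) := by
      refine integral_mono_on htT hp2i ((hq2i.const_mul 2).add (by simp)) fun τ hτ => ?_
      have h2 : p τ ≤ q τ + M * K * Q := (hpq τ hτ.1).trans (by
        rw [mul_assoc]
        gcongr
        exact hdrift τ hτ)
      have h3 : p τ ^ 2 ≤ (q τ + M * K * Q) ^ 2 := pow_le_pow_left₀ (hp τ) h2 2
      nlinarith [sq_nonneg (q τ - M * K * Q)]
    rw [intervalIntegral.integral_add (hq2i.const_mul 2) (by simp),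
      intervalIntegral.integral_const_mul] at h1
    refine h1.trans (le_of_eq ?_)
    simp [hS]
    ring
  have hen : ‖e (t + T)‖ ^ 2 - ‖e t‖ ^ 2 ≤ -2 * μ * S := by
    rw [norm_sq_sub_norm_sq_eq_integral hD htT he hd heFi]
    have : ∫ τ in t..t + T, (inner ℝ (e τ) (F τ) : ℝ) ≤ ∫ τ in t..t + T, -μ * q τ ^ 2 :=
      integral_mono_on htT heFi (hq2i.const_mul _) fun τ hτ => hdis τ hτ.1
    rw [intervalIntegral.integral_const_mul] at this
    linarith
  have hpos : 0 < 1 + (T * M * K) ^ 2 := by positivity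
  -- Cauchy–Schwarz `hCS` absorbs the drift term into the dissipation integral `S`.
  have hlow : α * ‖e t‖ ^ 2 ≤ 2 * (1 + (T * M * K) ^ 2) * S := by
    have : 2 * T * (M * K * Q) ^ 2 ≤ 2 * (T * M * K) ^ 2 * S := by
      calc 2 * T * (M * K * Q) ^ 2 = 2 * T * (M * K) ^ 2 * Q ^ 2 := by ring
        _ ≤ 2 * T * (M * K) ^ 2 * (T * S) := by gcongr
        _ = _ := by ring
    linarith
  have hkey : μ * α / (1 + (T * M * K) ^ 2) * ‖e t‖ ^ 2 ≤ 2 * μ * S := by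
    rw [div_mul_eq_mul_div, div_le_iff₀ hpos]
    nlinarith
  linarith

/-- Contraction gives geometric decay at the times s + kT, and monotonicity fills the gaps; the
factor `ρ⁻¹` pays for the last incomplete period. -/
theorem exponential_bound_of_contraction {V : ℝ → ℝ} {s T ρ : ℝ} (hT : 0 < T) (hρ : 0 < ρ)
    (hρ1 : ρ < 1) (hV : ∀ t, 0 ≤ V t)
    (hanti : ∀ t t', s ≤ t → t ≤ t' → V t' ≤ V t)
    (hcontr : ∀ t, s ≤ t → V (t + T) ≤ ρ * V t) {t : ℝ} (ht : s ≤ t) :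
    V t ≤ ρ⁻¹ * (ρ ^ (1 / T)) ^ (t - s) * V s := by
  have hk : ∀ k : ℕ, V (s + k * T) ≤ ρ ^ k * V s := by
    intro k
    induction k with
    | zero => simp
    | succ k ih =>
      have h1 := hcontr (s + k * T) (by nlinarith [k.cast_nonneg (α := ℝ)])
      rw [show s + ((k + 1 : ℕ) : ℝ) * T = s + k * T + T by push_cast; ring, pow_succ]
      nlinarith
  have hr : 0 ≤ (t - s) / T := div_nonneg (by linarith) hT.le
  set k := ⌊(t - s) / T⌋₊ with hkdef
  have hk1 : (k : ℝ) ≤ (t - s) / T := Nat.floor_le hr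
  have hk2 : (t - s) / T - 1 ≤ k := by linarith [Nat.lt_floor_add_one ((t - s) / T)]
  have hle : s + k * T ≤ t := by
    rw [le_div_iff₀ hT] at hk1
    linarith
  calc V t ≤ V (s + k * T) := hanti _ _ (by nlinarith [k.cast_nonneg (α := ℝ)]) hle
    _ ≤ ρ ^ k * V s := hk k
    _ ≤ ρ⁻¹ * (ρ ^ (1 / T)) ^ (t - s) * V s := by
        refine mul_le_mul_of_nonneg_right ?_ (hV s)
        rw [← Real.rpow_natCast, ← Real.rpow_mul hρ.le, ← Real.rpow_neg_one, ← Real.rpow_add hρ]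
        refine Real.rpow_le_rpow_of_exponent_ge hρ hρ1.le ?_
        calc -1 + 1 / T * (t - s) = (t - s) / T - 1 := by ring
          _ ≤ k := hk2

end Estimates

/-! ### From excitation to consensus -/

section Solutions

variable {n m : ℕ} {a : Matrix (Fin n) (Fin n) ℝ} {C : ℝ → EuclideanSpace ℝ (Fin m)}
  {s : ℝ} {x : ℝ → NetState n m}

theorem IsSolution.hasDerivAt_flowVec (hx : IsSolution a C s x) (hs : 0 ≤ s) {t : ℝ}
    (ht : s < t) (htD : t ∉ discontinuities C) : HasDerivAt x (flowVec a (C t) (x t)) t :=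
  hasDerivAt_piLp_of_apply
    (hx.hasDerivAt t ht (continuousAt_of_notMem_discontinuities (hs.trans_lt ht) htD))

theorem IsSolution.average_eq (hx : IsSolution a C s x) (ha : a.IsSymm)
    (hC : PiecewiseContinuous C) (hs : 0 ≤ s) {t : ℝ} (ht : s ≤ t) :
    average (x t) = average (x s) := by
  have hc : ContinuousOn (fun τ => average (x τ)) (Set.Icc s t) := by
    have h : Continuous fun z : NetState n m => average z := by
      unfold average
      fun_prop
    exact h.comp_continuousOn (hx.continuousOn.mono Set.Icc_subset_Ici_self)
  have hd : ∀ τ ∈ Set.Ioo s t \ discontinuities C,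
      HasDerivAt (fun τ => average (x τ)) (0 : EuclideanSpace ℝ (Fin m)) τ := by
    intro τ hτ
    have h := hx.hasDerivAt_flowVec hs hτ.1.1 hτ.2
    have h1 := (HasDerivAt.fun_sum fun k (_ : k ∈ Finset.univ) =>
      hasDerivAt_piLp_apply h k).const_smul (n : ℝ)⁻¹
    exact h1.congr_deriv (average_flowVec ha (C τ) (x τ))
  have h := integral_eq_of_hasDerivAt_off_countable_of_le _ _ ht
    hC.countable_discontinuities hc hd (by simp)
  rw [intervalIntegral.integral_zero] at h
  exact (sub_eq_zero.1 h.symm)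

theorem inner_flowVec (c : EuclideanSpace ℝ (Fin m)) (y z : NetState n m) :
    inner ℝ y (flowVec a c z) = inner ℝ (messageVec c y) (negLap a (messageVec c z)) := by
  rw [flowVec_eq_tensor, inner_tensor]

/-- Persistent excitation bounds every state by the energy of its messages. -/
theorem le_integral_norm_messageVec_sq (hC : PiecewiseContinuous C)
    {M : ℝ} (hM : ∀ t, 0 ≤ t → ‖C t‖ ≤ M) {α t T : ℝ} (ht : 0 ≤ t) (hT : 0 ≤ T)
    (h : ∀ u : EuclideanSpace ℝ (Fin m),
      α * ‖u‖ ^ 2 ≤ ∫ τ in t..t + T, (inner ℝ (C τ) u) ^ 2) (z : NetState n m) :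
    α * ‖z‖ ^ 2 ≤ ∫ τ in t..t + T, ‖messageVec (C τ) z‖ ^ 2 := by
  have h1 : ∀ τ, ‖messageVec (C τ) z‖ ^ 2 = ∑ i, (inner ℝ (C τ) (z i) : ℝ) ^ 2 := fun τ => by
    rw [EuclideanSpace.norm_sq_eq]
    simp [messageVec_apply]
  simp only [h1]
  rw [intervalIntegral.integral_finsetSum, PiLp.norm_sq_eq_of_L2, Finset.mul_sum]
  · exact Finset.sum_le_sum fun i _ => h (z i)
  · intro i _
    exact hC.intervalIntegrable_comp hM (G := fun c (_ : ℝ) => (inner ℝ c (z i) : ℝ) ^ 2)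
      (x := fun _ => (0 : ℝ)) (by fun_prop) ht (by linarith) continuousOn_const

theorem globalLinearConsensus_of_persistentlyExciting (hn : n ≠ 0) {G : SimpleGraph (Fin n)}
    (hG : G.Connected) (ha : IsWeightMatrix G a) (hC : PiecewiseContinuous C)
    {M : ℝ} (hM : ∀ t, 0 ≤ t → ‖C t‖ ≤ M) {t₀ : ℝ} (ht₀ : 0 ≤ t₀)
    (hPE : PersistentlyExciting C t₀) : GlobalLinearConsensus a C t₀ := by
  obtain ⟨α, T, hα, hT, hPE⟩ := hPE
  obtain ⟨μ, hμ, hgap⟩ := exists_inner_negLap_le hG ha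
  have hM0 : 0 ≤ M := (norm_nonneg _).trans (hM 0 le_rfl)
  set δ := μ * α / (1 + (T * M * (‖negLap a‖ * M)) ^ 2) with hδ
  have hδ0 : 0 < δ := by positivity
  -- `1 - δ` is not known to be positive here; the maximum with 1/2 makes `ρ⁻¹` and the real powers
  -- of `ρ` usable.
  set ρ := max (1 - δ) (1 / 2) with hρ
  have hρ0 : 0 < ρ := lt_max_of_lt_right (by norm_num)
  have hρ1 : ρ < 1 := max_lt (by linarith) (by norm_num)
  refine ⟨ρ⁻¹, ρ ^ (1 / T), by positivity, by positivity,
    Real.rpow_lt_one hρ0.le hρ1 (by positivity), fun s hs x hx t ht => ?_⟩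
  have hs0 : 0 ≤ s := ht₀.trans hs
  set e : ℝ → NetState n m := fun τ => x τ - consensus n (average (x s)) with he
  set F : ℝ → NetState n m := fun τ => flowVec a (C τ) (e τ) with hF
  have hcont : ∀ b c, s ≤ b → ContinuousOn e (Set.Icc b c) := fun b c hb =>
    (hx.continuousOn.mono fun τ hτ => hb.trans hτ.1).sub continuousOn_const
  have hderiv : ∀ τ, s < τ → τ ∉ discontinuities C → HasDerivAt e (F τ) τ := by
    intro τ h1 h2
    have h3 := (hx.hasDerivAt_flowVec hs0 h1 h2).sub_const (consensus n (average (x s)))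
    exact h3.congr_deriv (by simp only [hF, he, flowVec_sub, flowVec_consensus, sub_zero])
  have havg : ∀ τ, s ≤ τ → average (e τ) = 0 := fun τ hτ => by
    rw [he, average_sub, average_consensus hn, hx.average_eq ha.symm hC hs0 hτ, sub_self]
  have hdis : ∀ τ, s ≤ τ → inner ℝ (e τ) (F τ) ≤ -μ * ‖messageVec (C τ) (e τ)‖ ^ 2 := by
    intro τ hτ
    rw [hF, inner_flowVec]
    refine hgap _ ?_
    rw [sum_messageVec hn, havg τ hτ, inner_zero_right, mul_zero]
  have heF : ∀ b c, s ≤ b → b ≤ c →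
      IntervalIntegrable (fun τ => (inner ℝ (e τ) (F τ) : ℝ)) volume b c := fun b c hb hbc =>
    hC.intervalIntegrable_comp hM (G := fun c z => (inner ℝ z (flowVec a c z) : ℝ))
      (continuous_snd.inner (continuous_flowVec a)) (hs0.trans hb) hbc (hcont b c hb)
  have hV := exponential_bound_of_contraction (V := fun τ => ‖e τ‖ ^ 2) hT hρ0 hρ1
    (fun τ => by positivity) (s := s) ?_ ?_ ht
  · have h0 : ‖e s‖ ^ 2 ≤ ‖x s‖ ^ 2 :=
      pow_le_pow_left₀ (norm_nonneg _) (norm_sub_consensus_average_le hn (x s)) 2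
    calc ‖e t‖ ^ 2 ≤ ρ⁻¹ * (ρ ^ (1 / T)) ^ (t - s) * ‖e s‖ ^ 2 := hV
      _ ≤ ρ⁻¹ * (ρ ^ (1 / T)) ^ (t - s) * ‖x s‖ ^ 2 := by gcongr
      _ = _ := by ring
  · intro b c hb hbc
    refine norm_le_of_inner_deriv_nonpos hC.countable_discontinuities hbc (hcont b c hb)
      (fun τ h1 h2 => hderiv τ (hb.trans_lt h1) h2) (heF b c hb hbc) fun τ hτ => ?_
    exact (hdis τ (hb.trans hτ)).trans (by nlinarith [sq_nonneg ‖messageVec (C τ) (e τ)‖])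
  · intro b hb
    have hb0 : 0 ≤ b := hs0.trans hb
    have hbT : b ≤ b + T := by linarith
    have hmsg : Continuous fun p : EuclideanSpace ℝ (Fin m) × NetState n m =>
      ‖messageVec p.1 p.2‖ := continuous_messageVec.norm
    have hexc := le_integral_norm_messageVec_sq hC hM hb0 hT.le
      ((posSemidef_excitationGramian_sub_iff hC hM hb0 hT.le).1 (hPE b (hs.trans hb))) (e b)
    have hmain : ‖e (b + T)‖ ^ 2 ≤ (1 - δ) * ‖e b‖ ^ 2 := by
      refine norm_sq_le_of_excitation (q := fun τ => ‖messageVec (C τ) (e τ)‖)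
        (p := fun τ => ‖messageVec (C τ) (e b)‖) hC.countable_discontinuities hT hμ.le
        (by positivity) hM0 (hcont b _ hb) (fun τ h1 h2 => hderiv τ (hb.trans_lt h1) h2)
        (hC.intervalIntegrable_comp hM (continuous_flowVec a) hb0 hbT (hcont b _ hb))
        (heF b _ hb hbT)
        (hC.intervalIntegrable_comp hM (G := fun c z => ‖messageVec c z‖)
          hmsg hb0 hbT (hcont b _ hb))
        (hC.intervalIntegrable_comp hM (G := fun c z => ‖messageVec c z‖ ^ 2)
          (hmsg.pow 2) hb0 hbT (hcont b _ hb))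
        (hC.intervalIntegrable_comp hM (G := fun c z => ‖messageVec c z‖ ^ 2)
          (hmsg.pow 2) hb0 hbT continuousOn_const)
        (fun τ => norm_nonneg _) (fun τ => norm_nonneg _)
        (fun τ hτ => hdis τ (hb.trans hτ)) (fun τ hτ => ?_) (fun τ hτ => ?_) hexc
      · refine (norm_flowVec_le a (C τ) (e τ)).trans ?_
        gcongr
        exact hM τ (hb0.trans hτ)
      -- The message of the frozen state `e b` differs from that of `e τ` by the message of the
      -- drift.
      · have h1 : messageVec (C τ) (e b) =
            messageVec (C τ) (e τ) - messageVec (C τ) (e τ - e b) := by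
          rw [messageVec_sub _ (e τ) (e b), sub_sub_cancel]
        have h2 : ‖messageVec (C τ) (e τ - e b)‖ ≤ M * ‖e τ - e b‖ :=
          (norm_messageVec_le _ _).trans (by gcongr; exact hM τ (hb0.trans hτ))
        calc ‖messageVec (C τ) (e b)‖
            ≤ ‖messageVec (C τ) (e τ)‖ + ‖messageVec (C τ) (e τ - e b)‖ := by
              rw [h1]
              exact norm_sub_le _ _
          _ ≤ _ := by gcongr
    exact hmain.trans (by gcongr; exact le_max_left _ _)

/-! ### From consensus to excitation -/

/-- A direction of pure disagreement, which exists only with at least two nodes. -/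
theorem exists_unit_sum_eq_zero (hn : 2 ≤ n) :
    ∃ v : EuclideanSpace ℝ (Fin n), ‖v‖ = 1 ∧ ∑ i, v i = 0 := by
  set i₀ : Fin n := ⟨0, by omega⟩
  set i₁ : Fin n := ⟨1, by omega⟩
  set v : EuclideanSpace ℝ (Fin n) := EuclideanSpace.single i₀ 1 - EuclideanSpace.single i₁ 1
    with hv
  have hne : i₀ ≠ i₁ := by simp [i₀, i₁]
  have h0 : v ≠ 0 := by
    intro h
    have := congrArg (fun w : EuclideanSpace ℝ (Fin n) => w i₀) h
    simp [hv, hne] at this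
  have hsum : ∑ i, v i = 0 := by simp [hv]
  exact ⟨‖v‖⁻¹ • v, by simp [norm_smul, h0], by simp [← Finset.mul_sum, hsum]⟩

theorem average_tensor {v : EuclideanSpace ℝ (Fin n)} (hv : ∑ i, v i = 0)
    (u : EuclideanSpace ℝ (Fin m)) : average (tensor v u) = 0 := by
  have : ∑ i, tensor v u i = (∑ i, v i) • u := by
    rw [Finset.sum_smul]
    rfl
  simp [average, this, hv]

theorem consensus_zero : consensus n (0 : EuclideanSpace ℝ (Fin m)) = 0 := rfl

theorem persistentlyExciting_of_globalLinearConsensus (hn : 2 ≤ n) (hC : PiecewiseContinuous C)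
    {M : ℝ} (hM : ∀ t, 0 ≤ t → ‖C t‖ ≤ M) {t₀ : ℝ} (ht₀ : 0 ≤ t₀)
    (hcons : GlobalLinearConsensus a C t₀) : PersistentlyExciting C t₀ := by
  obtain ⟨c, γ, hc, hγ, hγ1, hcons⟩ := hcons
  obtain ⟨v, hv1, hv0⟩ := exists_unit_sum_eq_zero hn
  have hM0 : 0 ≤ M := (norm_nonneg _).trans (hM 0 le_rfl)
  -- The bound 1/(4c) makes c γ^T at most 1/4, so the norm is halved after time `T`; `T = k + 1`
  -- ensures `T > 0`.
  obtain ⟨k, hk⟩ := exists_pow_lt_of_lt_one (show 0 < 1 / (4 * c) by positivity) hγ1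
  set T : ℝ := k + 1 with hTdef
  have hT : 0 < T := by positivity
  have hγT : c * γ ^ T ≤ 1 / 4 := by
    have h1 : γ ^ T ≤ γ ^ (k : ℝ) :=
      Real.rpow_le_rpow_of_exponent_ge hγ hγ1.le (by simp [hTdef])
    rw [Real.rpow_natCast] at h1
    have h2 : c * γ ^ T ≤ c * (1 / (4 * c)) := by
      gcongr
      exact h1.trans hk.le
    refine h2.trans (le_of_eq ?_)
    field_simp
  -- `B * ‖u‖` bounds the factor multiplying |⟨C, u⟩| in the flow along the initial state; the added
  -- 1 keeps `B` positive.
  set B : ℝ := ‖negLap a‖ * M * √c + 1 with hB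
  have hB0 : 0 < B := by positivity
  -- The constant combines `hu`, ‖u‖ ≤ 2BQ, with `hCS`, Q² ≤ T ∫ ⟨C, u⟩².
  refine ⟨1 / (4 * B ^ 2 * T), T, by positivity, hT, fun s hs => ?_⟩
  have hs0 : 0 ≤ s := ht₀.trans hs
  have hsT : s ≤ s + T := by linarith
  rw [posSemidef_excitationGramian_sub_iff hC hM hs0 hT.le]
  intro u
  obtain ⟨x, hx, hxs⟩ := exists_isSolution a hC hM hs0 (tensor v u)
  have hnorm : ‖x s‖ = ‖u‖ := by rw [hxs, norm_tensor, hv1, one_mul]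
  have hdecay : ∀ t, s ≤ t → ‖x t‖ ^ 2 ≤ c * ‖u‖ ^ 2 * γ ^ (t - s) := by
    intro t ht
    have h := hcons s hs x hx t ht
    rwa [hnorm, hxs, average_tensor hv0, consensus_zero, sub_zero] at h
  have hxb : ∀ t, s ≤ t → ‖x t‖ ≤ √c * ‖u‖ := by
    intro t ht
    refine abs_le_of_sq_le_sq' ?_ (by positivity) |>.2
    rw [mul_pow, Real.sq_sqrt hc.le]
    refine (hdecay t ht).trans (mul_le_of_le_one_right (by positivity) ?_)
    exact Real.rpow_le_one hγ.le hγ1.le (by linarith)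
  have hend : ‖x (s + T)‖ ≤ ‖u‖ / 2 := by
    refine abs_le_of_sq_le_sq' ?_ (by positivity) |>.2
    have h := hdecay (s + T) hsT
    rw [add_sub_cancel_left] at h
    nlinarith [sq_nonneg ‖u‖]
  have hq : ∀ {G : EuclideanSpace ℝ (Fin m) → ℝ}, Continuous G →
      IntervalIntegrable (fun τ => G (C τ)) volume s (s + T) := fun {G} hG =>
    hC.intervalIntegrable_comp hM (G := fun c (_ : ℝ) => G c) (x := fun _ => (0 : ℝ))
      (hG.comp continuous_fst) hs0 hsT continuousOn_const
  have hqi := hq (G := fun c => ‖(inner ℝ c u : ℝ)‖) (by fun_prop)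
  have hq2i := hq (G := fun c => ‖(inner ℝ c u : ℝ)‖ ^ 2) (by fun_prop)
  set Q := ∫ τ in s..s + T, ‖(inner ℝ (C τ) u : ℝ)‖ with hQ
  have hxc : ContinuousOn x (Set.Icc s (s + T)) := hx.continuousOn.mono Set.Icc_subset_Ici_self
  have hftc : ∫ τ in s..s + T, (inner ℝ (x s) (flowVec a (C τ) (x τ)) : ℝ) =
      inner ℝ (x s) (x (s + T)) - inner ℝ (x s) (x s) := by
    refine integral_eq_of_hasDerivAt_off_countable_of_le (fun τ => (inner ℝ (x s) (x τ) : ℝ)) _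
      hsT hC.countable_discontinuities (continuousOn_const.inner hxc) (fun τ hτ => ?_) ?_
    · have h := hx.hasDerivAt_flowVec hs0 hτ.1.1 hτ.2
      simpa using (hasDerivAt_const τ (x s)).inner ℝ h
    · exact hC.intervalIntegrable_comp hM
        (G := fun c z => (inner ℝ (x s) (flowVec a c z) : ℝ))
        (continuous_const.inner (continuous_flowVec a)) hs0 hsT hxc
  have hbound : ‖∫ τ in s..s + T, (inner ℝ (x s) (flowVec a (C τ) (x τ)) : ℝ)‖ ≤
      B * ‖u‖ * Q := by
    rw [hQ, ← intervalIntegral.integral_const_mul]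
    refine intervalIntegral.norm_integral_le_of_norm_le hsT
      (Eventually.of_forall fun τ hτ => ?_) (hqi.const_mul _)
    have h1 : ‖messageVec (C τ) (x τ)‖ ≤ M * (√c * ‖u‖) :=
      (norm_messageVec_le _ _).trans
        (mul_le_mul (hM τ (hs0.trans hτ.1.le)) (hxb τ hτ.1.le) (norm_nonneg _) hM0)
    rw [inner_flowVec, hxs, messageVec_tensor]
    calc ‖(inner ℝ ((inner ℝ (C τ) u : ℝ) • v) (negLap a (messageVec (C τ) (x τ))) : ℝ)‖
        ≤ ‖(inner ℝ (C τ) u : ℝ) • v‖ * ‖negLap a (messageVec (C τ) (x τ))‖ :=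
          norm_inner_le_norm _ _
      _ ≤ ‖(inner ℝ (C τ) u : ℝ)‖ * (‖negLap a‖ * (M * (√c * ‖u‖))) := by
          rw [norm_smul, hv1, mul_one]
          gcongr
          exact (negLap a).le_opNorm_of_le h1
      _ = ‖negLap a‖ * M * √c * (‖u‖ * ‖(inner ℝ (C τ) u : ℝ)‖) := by ring
      _ ≤ B * (‖u‖ * ‖(inner ℝ (C τ) u : ℝ)‖) := by
          gcongr
          exact (lt_add_one _).le
      _ = _ := by ring
  -- Along the initial state, the inner product falls from ‖u‖² to at most ‖u‖²/2.
  have hlow : ‖u‖ ^ 2 / 2 ≤ B * ‖u‖ * Q := by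
    have h1 : (inner ℝ (x s) (x (s + T)) : ℝ) ≤ ‖u‖ * (‖u‖ / 2) :=
      (real_inner_le_norm _ _).trans (by rw [hnorm]; gcongr)
    rw [hftc, real_inner_self_eq_norm_sq, hnorm, Real.norm_eq_abs] at hbound
    have h2 := (abs_le.1 hbound).1
    linarith
  have hQ0 : 0 ≤ Q := integral_nonneg hsT fun τ _ => norm_nonneg _
  have hu : ‖u‖ ≤ 2 * B * Q := by
    rcases (norm_nonneg u).eq_or_lt with h | h
    · rw [← h]
      positivity
    · nlinarith
  have hCS : Q ^ 2 ≤ T * ∫ τ in s..s + T, (inner ℝ (C τ) u : ℝ) ^ 2 := by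
    have h := sq_integral_le (by linarith : s < s + T) hqi hq2i
    rw [add_sub_cancel_left] at h
    simpa only [hQ, Real.norm_eq_abs, sq_abs] using h
  rw [div_mul_eq_mul_div, one_mul, div_le_iff₀ (by positivity)]
  calc ‖u‖ ^ 2 ≤ (2 * B * Q) ^ 2 := pow_le_pow_left₀ (norm_nonneg _) hu 2
    _ = 4 * B ^ 2 * Q ^ 2 := by ring
    _ ≤ 4 * B ^ 2 * (T * ∫ τ in s..s + T, (inner ℝ (C τ) u : ℝ) ^ 2) := by gcongr
    _ = _ := by ring

end Solutions

end CompressedConsensus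

end

theorem theorem1 {n m : ℕ} (hn : 2 ≤ n)
    (G : SimpleGraph (Fin n)) (hG : G.Connected)
    (a : Matrix (Fin n) (Fin n) ℝ) (ha : CompressedConsensus.IsWeightMatrix G a)
    (C : ℝ → EuclideanSpace ℝ (Fin m)) (hC : CompressedConsensus.PiecewiseContinuous C)
    (hCb : ∃ M : ℝ, ∀ t, 0 ≤ t → ‖C t‖ ≤ M)
    (t₀ : ℝ) (ht₀ : 0 ≤ t₀) :
    CompressedConsensus.GlobalLinearConsensus a C t₀ ↔
      CompressedConsensus.PersistentlyExciting C t₀ := by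
  obtain ⟨M, hM⟩ := hCb
  exact ⟨CompressedConsensus.persistentlyExciting_of_globalLinearConsensus hn hC hM ht₀,
    CompressedConsensus.globalLinearConsensus_of_persistentlyExciting (by omega) hG ha hC hM ht₀⟩
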